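/- Fix $n$. Let $\mathcal L_2^n$ be the space of square-integrable signals $[0,\infty)\to\mathbb R^n$ (up to equality a.e.), with its usual norm and inner product, let $\mathcal P_T$ denote truncation of a signal to $[0,T]$, and let $\mathcal L_{2e}^n$ be the space of signals $u$ with $\mathcal P_T u\in\mathcal L_2^n$ for all $T\ge 0$. An operator $H:\mathcal L_{2e}^n\to\mathcal L_{2e}^n$ is causal if $\mathcal P_T(Hu)=\mathcal P_T(H(\mathcal P_Tu))$ for all $T\ge0$ and all $u$, and $\mathcal L_2$-stable if there is $\gamma\ge 0$ such that $Hu\in\mathcal L_2^n$ and $\|Hu\|\le\gamma\|u\|$ for all $u\in\mathcal L_2^n$. The soft scaled graph of an $\mathcal L_2$-stable $H$ is $$\mathrm{SG}(H)=\Big\{\tfrac{\|y\|}{\|u\|}\,e^{\pm \mathrm j\theta(u,y)} : u\in\mathcal L_2^n\setminus\{0\},\ y=Hu\Big\},\qquad \theta(u,y)=\arccos\frac{\langle u,y\rangle}{\|u\|\|y\|},\quad \theta(u,0)=0 .$$ A multiplier $\Pi=\begin{bmatrix}a&b\\ b&c\end{bmatrix}\in\mathbb R^{2\times2}$ is positive-negative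 if, for some $\varepsilon>0$, $c\ge\varepsilon$ and $a\le-\varepsilon$; its region is $\mathcal S(\Pi)=\{z\in\mathbb C: a|z|^2+2b\,\mathrm{Re}\,z+c\ge0\}$. Put $\mathcal S^{-1}(\Pi)=\{1/z: z\in\mathcal S(\Pi),\ z\ne0\}$ (the point $1/0=\infty$, which has infinite distance from every complex number, plays no role), and for $A,B\subset\mathbb C$ let $\mathrm{dist}(A,B)=\inf_{a\in A,\,b\in B}|a-b|$. Let $H_1,H_2:\mathcal L_{2e}^n\to\mathcal L_{2e}^n$ be causal and $\mathcal L_2$-stable, and let $\Pi_1,\Pi_2$ be positive-negative multipliers with $\mathrm{SG}(H_i)\subset\mathcal S(\Pi_i)$ for $i=1,2$. Suppose that $$\mathrm{dist}\big(\mathcal S^{-1}(\Pi_1),\,-\mathcal S(\Pi_2)\big)>0 .$$ 1. If the negative feedback loop $e=u-H_2y$, $y=H_1e$ is well-posed, that is, the map $e\mapsto u=e+H_2(H_1e)$ has a causal inverse on $\mathcal L_{2e}^n$, then the loop is $\mathcal L_2$-stable: the closed-loop maps $u\mapsto e$ and $u\mapsto y$ are $\mathcal L_2$-stable. 2. Likewise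 for the loop with external signals at both summation points, $e_1=u_1-H_2e_2$, $e_2=u_2+H_1e_1$: if it is well-posed, that is, the map $(e_1,e_2)\mapsto(u_1,u_2)$ has a causal inverse on $\mathcal L_{2e}^n\times\mathcal L_{2e}^n$, then it is $\mathcal L_2$-stable: there is $\gamma\ge0$ such that $u_1,u_2\in\mathcal L_2^n$ implies $e_1,e_2\in\mathcal L_2^n$ and $\|e_1\|^2+\|e_2\|^2\le\gamma(\|u_1\|^2+\|u_2\|^2)$. -/

import Mathlib

open MeasureTheory
open scoped NNReal ENNReal

noncomputable section

namespace ScaledGraph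

/-! ### Signal spaces -/

/-- Lebesgue measure on the time axis `[0, ∞)`. -/
abbrev timeMeasure : Measure ℝ := volume.restrict (Set.Ici (0 : ℝ))

/-- Measurable signals `[0, ∞) → ℝⁿ`, up to equality almost everywhere. -/
abbrev Signal (n : ℕ) : Type := ℝ →ₘ[timeMeasure] EuclideanSpace ℝ (Fin n)

/-- The space `L₂ⁿ` of square-integrable signals, a real Hilbert space (norm and inner product are
Mathlib's). It is an additive subgroup of `Signal n`. -/
abbrev L2 (n : ℕ) : AddSubgroup (Signal n) := Lp (EuclideanSpace ℝ (Fin n)) 2 timeMeasure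

/-- Truncation to `[0, T]`: the signal equals `u` on `[0, T]` and `0` afterwards. -/
def trunc {n : ℕ} (T : ℝ≥0) (u : Signal n) : Signal n :=
  AEEqFun.mk ((Set.Icc (0 : ℝ) T).indicator u)
    (u.aestronglyMeasurable.indicator measurableSet_Icc)

theorem coeFn_trunc {n : ℕ} (T : ℝ≥0) (u : Signal n) :
    trunc T u =ᵐ[timeMeasure] (Set.Icc (0 : ℝ) T).indicator u :=
  AEEqFun.coeFn_mk _ _

theorem trunc_zero {n : ℕ} (T : ℝ≥0) : trunc T (0 : Signal n) = 0 := by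
  refine AEEqFun.ext ?_
  filter_upwards [coeFn_trunc T (0 : Signal n),
    AEEqFun.coeFn_zero (α := ℝ) (μ := timeMeasure) (β := EuclideanSpace ℝ (Fin n))] with t h1 h2
  rw [h1, h2]
  by_cases ht : t ∈ Set.Icc (0 : ℝ) T
  · simp [Set.indicator_of_mem ht, h2]
  · simp [Set.indicator_of_notMem ht]

theorem trunc_add {n : ℕ} (T : ℝ≥0) (u v : Signal n) :
    trunc T (u + v) = trunc T u + trunc T v := by
  refine AEEqFun.ext ?_
  filter_upwards [coeFn_trunc T (u + v), coeFn_trunc T u, coeFn_trunc T v,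
    AEEqFun.coeFn_add u v, AEEqFun.coeFn_add (trunc T u) (trunc T v)] with t h1 h2 h3 h4 h5
  rw [h1, h5, Pi.add_apply, h2, h3]
  by_cases ht : t ∈ Set.Icc (0 : ℝ) T
  · simp [Set.indicator_of_mem ht, h4]
  · simp [Set.indicator_of_notMem ht]

theorem trunc_neg {n : ℕ} (T : ℝ≥0) (u : Signal n) : trunc T (-u) = -trunc T u := by
  refine AEEqFun.ext ?_
  filter_upwards [coeFn_trunc T (-u), coeFn_trunc T u,
    AEEqFun.coeFn_neg u, AEEqFun.coeFn_neg (trunc T u)] with t h1 h2 h3 h4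
  rw [h1, h4, Pi.neg_apply, h2]
  by_cases ht : t ∈ Set.Icc (0 : ℝ) T
  · simp [Set.indicator_of_mem ht, h3]
  · simp [Set.indicator_of_notMem ht]

theorem trunc_mem_L2 {n : ℕ} (T : ℝ≥0) {u : Signal n} (hu : u ∈ L2 n) : trunc T u ∈ L2 n := by
  rw [Lp.mem_Lp_iff_eLpNorm_lt_top] at hu ⊢
  rw [eLpNorm_congr_ae (coeFn_trunc T u)]
  exact (eLpNorm_indicator_le _).trans_lt hu

/-- The extended space `L₂ₑⁿ`: all signals whose truncations are square-integrable. -/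
def L2e (n : ℕ) : AddSubgroup (Signal n) where
  carrier := {u | ∀ T : ℝ≥0, trunc T u ∈ L2 n}
  zero_mem' T := by rw [trunc_zero]; exact zero_mem _
  add_mem' hu hv T := by rw [trunc_add]; exact add_mem (hu T) (hv T)
  neg_mem' hu T := by rw [trunc_neg]; exact neg_mem (hu T)

/-- The inclusion `L₂ⁿ ⊆ L₂ₑⁿ`. -/
def ofL2 {n : ℕ} (u : L2 n) : L2e n := ⟨(u : Signal n), fun T => trunc_mem_L2 T u.2⟩

/-- The truncation operator `P_T` on `L₂ₑⁿ`. -/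
def P {n : ℕ} (T : ℝ≥0) (u : L2e n) : L2e n :=
  ⟨trunc T (u : Signal n), fun S => trunc_mem_L2 S (u.2 T)⟩

/-! ### Systems -/

/-- Causality: `P_T (H u) = P_T (H (P_T u))`. -/
def IsCausal {n : ℕ} (H : L2e n → L2e n) : Prop :=
  ∀ (T : ℝ≥0) (u : L2e n), P T (H u) = P T (H (P T u))

/-- `L₂`-stability: `H` maps `L₂ⁿ` into `L₂ⁿ` with finite gain. -/
def IsL2Stable {n : ℕ} (H : L2e n → L2e n) : Prop :=
  ∃ γ : ℝ, 0 ≤ γ ∧ ∀ u : L2 n, ∃ y : L2 n, H (ofL2 u) = ofL2 y ∧ ‖y‖ ≤ γ * ‖u‖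

/-! ### Scaled graphs -/

/-- The gain `ρ(u, y)`. -/
def gain {n : ℕ} (u y : L2 n) : ℝ := ‖y‖ / ‖u‖

open Classical in
/-- The phase `θ(u, y)`, with `θ(u, 0) = 0`. -/
def phase {n : ℕ} (u y : L2 n) : ℝ :=
  if y = 0 then 0 else Real.arccos (inner ℝ u y / (‖u‖ * ‖y‖))

/-- The soft scaled graph: all `ρ(u, y) e^{± j θ(u, y)}` with `u ∈ L₂ⁿ`, `u ≠ 0`, `y = H u`. -/
def softSG {n : ℕ} (H : L2e n → L2e n) : Set ℂ :=
  {z | ∃ u y : L2 n, u ≠ 0 ∧ ofL2 y = H (ofL2 u) ∧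
    (z = gain u y * Complex.exp (Complex.I * phase u y) ∨
      z = gain u y * Complex.exp (-(Complex.I * phase u y)))}

/-! ### Multipliers and their regions -/

/-- A real `2 × 2` multiplier `[a b; b c]` is positive-negative if it is symmetric and, for some
`ε > 0`, its (here scalar) diagonal blocks satisfy `c ≥ ε` and `a ≤ -ε`. -/
def IsPositiveNegative (M : Matrix (Fin 2) (Fin 2) ℝ) : Prop :=
  M.IsSymm ∧ ∃ ε : ℝ, 0 < ε ∧ ε ≤ M 1 1 ∧ M 0 0 ≤ -ε

/-- The multiplier region: all `z ∈ ℂ` with `[z; 1]* M [z; 1] ≥ 0`. (The quadratic form is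
real-valued for symmetric `M`.) -/
def region (M : Matrix (Fin 2) (Fin 2) ℝ) : Set ℂ :=
  {z | 0 ≤ (star ![z, 1] ⬝ᵥ (M.map Complex.ofReal).mulVec ![z, 1]).re}

/-- For symmetric `M` the region is `{z | a |z|² + 2 b Re z + c ≥ 0}`. -/
theorem mem_region_iff {M : Matrix (Fin 2) (Fin 2) ℝ} (hM : M.IsSymm) (z : ℂ) :
    z ∈ region M ↔ 0 ≤ M 0 0 * ‖z‖ ^ 2 + 2 * M 0 1 * z.re + M 1 1 := by
  have h : M 1 0 = M 0 1 := hM.apply 0 1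
  have e : (star ![z, 1] ⬝ᵥ (M.map Complex.ofReal).mulVec ![z, 1]).re
      = M 0 0 * ‖z‖ ^ 2 + 2 * M 0 1 * z.re + M 1 1 := by
    rw [← Complex.normSq_eq_norm_sq, Complex.normSq_apply]
    simp [Matrix.mulVec, dotProduct, Fin.sum_univ_two, h]
    ring
  rw [region, Set.mem_ofPred_eq, e]

/-- The inverse `S⁻¹ = {1/z : z ∈ S}` of a set of complex numbers. For `z = 0` the value `1/z` is
the point at infinity, which is at infinite distance from every complex number and is left out;
in particular `0⁻¹` is not read as `0`. -/
def invSet (S : Set ℂ) : Set ℂ := {w | ∃ z ∈ S, z ≠ 0 ∧ w = 1 / z}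

/-- The distance between two sets, `inf {|x - y| : x ∈ A, y ∈ B}`. -/
def setDist (A B : Set ℂ) : ℝ≥0∞ := ⨅ x ∈ A, ⨅ y ∈ B, edist x y

/-! ### The negative feedback interconnection

`e = u - H₂ y`, `y = H₁ e`, with external input `u`. -/

/-- `R` is a causal inverse on `L₂ₑⁿ` of the map `e ↦ u = e + H₂ (H₁ e)`; that is, for every input
`u` the loop equations have exactly one solution `e = R u`, and it depends causally on `u`. -/
def IsLoopInverse {n : ℕ} (H₁ H₂ R : L2e n → L2e n) : Prop :=
  IsCausal R ∧ ∀ u e : L2e n, e = u - H₂ (H₁ e) ↔ e = R u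

/-- Well-posedness of the loop: the map from internal to external signals has a causal inverse. -/
def IsWellPosed {n : ℕ} (H₁ H₂ : L2e n → L2e n) : Prop :=
  ∃ R : L2e n → L2e n, IsLoopInverse H₁ H₂ R

/-- `L₂`-stability of the well-posed loop: the closed-loop maps `u ↦ e` and `u ↦ y = H₁ e` are
`L₂`-stable. -/
def IsFeedbackL2Stable {n : ℕ} (H₁ H₂ : L2e n → L2e n) : Prop :=
  ∃ R : L2e n → L2e n, IsLoopInverse H₁ H₂ R ∧ IsL2Stable R ∧ IsL2Stable (H₁ ∘ R)

/-! The same loop with an external signal at both summation points: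
`e₁ = u₁ - H₂ e₂`, `e₂ = u₂ + H₁ e₁`. -/

/-- `R` is a causal inverse on `L₂ₑⁿ × L₂ₑⁿ` of `(e₁, e₂) ↦ (u₁, u₂)`. -/
def IsLoopInverse₂ {n : ℕ} (H₁ H₂ : L2e n → L2e n) (R : L2e n × L2e n → L2e n × L2e n) : Prop :=
  (∀ (T : ℝ≥0) (u₁ u₂ : L2e n),
    Prod.map (P T) (P T) (R (u₁, u₂)) = Prod.map (P T) (P T) (R (P T u₁, P T u₂))) ∧
  ∀ u₁ u₂ e₁ e₂ : L2e n, (e₁ = u₁ - H₂ e₂ ∧ e₂ = u₂ + H₁ e₁) ↔ (e₁, e₂) = R (u₁, u₂)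

/-- Well-posedness of the two-input loop. -/
def IsWellPosed₂ {n : ℕ} (H₁ H₂ : L2e n → L2e n) : Prop :=
  ∃ R : L2e n × L2e n → L2e n × L2e n, IsLoopInverse₂ H₁ H₂ R

/-- `L₂`-stability of the two-input loop: `(u₁, u₂) ↦ (e₁, e₂)` has finite `L₂`-gain. -/
def IsFeedbackL2Stable₂ {n : ℕ} (H₁ H₂ : L2e n → L2e n) : Prop :=
  ∃ R : L2e n × L2e n → L2e n × L2e n, IsLoopInverse₂ H₁ H₂ R ∧
    ∃ γ : ℝ, 0 ≤ γ ∧ ∀ u₁ u₂ : L2 n, ∃ e₁ e₂ : L2 n,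
      R (ofL2 u₁, ofL2 u₂) = (ofL2 e₁, ofL2 e₂) ∧
        ‖e₁‖ ^ 2 + ‖e₂‖ ^ 2 ≤ γ * (‖u₁‖ ^ 2 + ‖u₂‖ ^ 2)

end ScaledGraph

end

namespace ScaledGraph

/-! Each scaled-graph inclusion is a quadratic constraint on input-output pairs in `L₂`. Causality
and `a ≤ 0` carry it over to truncations (`quadForm_truncL2_nonneg`), so no homotopy is needed and
the loop can be estimated on each `[0, T]`.

On the real axis, `-S(Π₂)` is an interval with centre `p` and radius `r`, and `S⁻¹(Π₁)` is, apart
from `0`, the exterior of an open interval with centre `q` and radius `R`. Disjointness forces `|p -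
q| + r < R`. In any inner product space the same constants give `‖y₂ + p e₂‖ ≤ r‖e₂‖` and `‖e₁ - q
y₁‖ ≥ R‖y₁‖`. With `y₂ = u₁ - e₁` and `y₁ = e₂ - u₂`, the triangle inequality bounds `e₁, e₂` by
`u₁, u₂` (`exists_norm_le_of_quadForm_nonneg`). The bound is uniform in `T`, so Fatou's lemma places
the solutions in `L₂`. -/

/-- The quadratic form of a multiplier on a pair (input, output) of vectors. -/
def quadForm {V : Type*} [NormedAddCommGroup V] [InnerProductSpace ℝ V]
    (M : Matrix (Fin 2) (Fin 2) ℝ) (u y : V) : ℝ :=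
  M 0 0 * ‖y‖ ^ 2 + 2 * M 0 1 * inner ℝ u y + M 1 1 * ‖u‖ ^ 2

/-! ### Truncations as elements of `L₂` -/

/-- The truncation of an extended signal, as an element of `L₂`. -/
noncomputable def truncL2 {n : ℕ} (T : ℝ≥0) (u : L2e n) : L2 n := ⟨trunc T (u : Signal n), u.2 T⟩

theorem ofL2_truncL2 {n : ℕ} (T : ℝ≥0) (u : L2e n) : ofL2 (truncL2 T u) = P T u := rfl

theorem truncL2_eq_of_P_eq {n : ℕ} {T : ℝ≥0} {u v : L2e n} (h : P T u = P T v) :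
    truncL2 T u = truncL2 T v := by
  have h' : trunc T (u : Signal n) = trunc T (v : Signal n) := congrArg Subtype.val h
  exact Subtype.ext h'

theorem truncL2_add {n : ℕ} (T : ℝ≥0) (u v : L2e n) :
    truncL2 T (u + v) = truncL2 T u + truncL2 T v :=
  Subtype.ext (trunc_add T _ _)

theorem truncL2_neg {n : ℕ} (T : ℝ≥0) (u : L2e n) : truncL2 T (-u) = -truncL2 T u :=
  Subtype.ext (trunc_neg T _)

theorem truncL2_sub {n : ℕ} (T : ℝ≥0) (u v : L2e n) :
    truncL2 T (u - v) = truncL2 T u - truncL2 T v := by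
  rw [sub_eq_add_neg, truncL2_add, truncL2_neg, ← sub_eq_add_neg]

theorem norm_truncL2_ofL2_le {n : ℕ} (T : ℝ≥0) (u : L2 n) : ‖truncL2 T (ofL2 u)‖ ≤ ‖u‖ := by
  refine Lp.norm_le_norm_of_ae_le ?_
  filter_upwards [coeFn_trunc T (u : Signal n)] with t ht
  change ‖(trunc T (u : Signal n)) t‖ ≤ _
  rw [ht]
  exact norm_indicator_le_norm_self _ _

/-- The left factor vanishes after `T`, so the tail of `y` does not contribute. -/
theorem inner_truncL2_left {n : ℕ} (T : ℝ≥0) (u : L2e n) (y : L2 n) :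
    inner ℝ (truncL2 T u) y = inner ℝ (truncL2 T u) (truncL2 T (ofL2 y)) := by
  rw [L2.inner_def, L2.inner_def]
  refine integral_congr_ae ?_
  filter_upwards [coeFn_trunc T (u : Signal n), coeFn_trunc T (y : Signal n)] with t hu hy
  change inner ℝ ((trunc T (u : Signal n)) t) _
    = inner ℝ ((trunc T (u : Signal n)) t) ((trunc T (y : Signal n)) t)
  rw [hu, hy]
  by_cases ht : t ∈ Set.Icc (0 : ℝ) T
  · simp [Set.indicator_of_mem ht]
  · simp [Set.indicator_of_notMem ht]

/-- An extended signal with uniformly bounded truncations is square-integrable. -/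
theorem exists_ofL2_eq_of_norm_truncL2_le {n : ℕ} {u : L2e n} {C : ℝ} (hC : 0 ≤ C)
    (h : ∀ T, ‖truncL2 T u‖ ≤ C) : ∃ v : L2 n, ofL2 v = u ∧ ‖v‖ ≤ C := by
  have hk : ∀ T : ℝ≥0, eLpNorm (trunc T (u : Signal n)) 2 timeMeasure ≤ ENNReal.ofReal C :=
    fun T => (ENNReal.le_ofReal_iff_toReal_le (u.2 T).ne hC).2 (h T)
  have hle : eLpNorm (u : Signal n) 2 timeMeasure ≤ ENNReal.ofReal C := by
    -- Fatou along integer horizons: at each `t ≥ 0` the truncations are eventually equal to `u t`.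
    refine (Lp.eLpNorm_lim_le_liminf_eLpNorm
      (f := fun k : ℕ => ((trunc (k : ℝ≥0) (u : Signal n) : Signal n) :
        ℝ → EuclideanSpace ℝ (Fin n)))
      (fun k => AEEqFun.aestronglyMeasurable _) _ ?_).trans ?_
    · have hae : ∀ᵐ t ∂timeMeasure, ∀ k : ℕ, trunc (k : ℝ≥0) (u : Signal n) t
          = (Set.Icc (0 : ℝ) ((k : ℝ≥0) : ℝ)).indicator (u : Signal n) t :=
        ae_all_iff.2 fun k => coeFn_trunc _ _
      filter_upwards [hae, ae_restrict_mem measurableSet_Ici] with t ht h0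
      obtain ⟨N, hN⟩ := exists_nat_ge t
      refine tendsto_const_nhds.congr' ?_
      filter_upwards [Filter.eventually_ge_atTop N] with k hk
      rw [ht k, Set.indicator_of_mem]
      refine ⟨h0, hN.trans ?_⟩
      simpa using hk
    · exact Filter.liminf_le_of_frequently_le' (Filter.Frequently.of_forall fun k => hk (k : ℝ≥0))
  have hmem : (u : Signal n) ∈ L2 n :=
    Lp.mem_Lp_iff_eLpNorm_lt_top.2 (hle.trans_lt ENNReal.ofReal_lt_top)
  refine ⟨⟨u, hmem⟩, rfl, ?_⟩
  rw [Lp.norm_def]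
  exact ENNReal.toReal_le_of_le_ofReal hC hle

/-! ### Scaled graphs and quadratic constraints -/

theorem ofL2_injective {n : ℕ} : Function.Injective (ofL2 (n := n)) := fun u v h => by
  have h' : (ofL2 u : Signal n) = ofL2 v := congrArg Subtype.val h
  exact Subtype.ext h'

/-- The multiplier form is nonnegative on the graph of an operator whose soft scaled graph lies in
the region of the multiplier. -/
theorem quadForm_nonneg_of_softSG_subset {n : ℕ} {H : L2e n → L2e n} (hH : IsL2Stable H)
    {M : Matrix (Fin 2) (Fin 2) ℝ} (hM : M.IsSymm) (hSG : softSG H ⊆ region M) {u y : L2 n}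
    (hy : ofL2 y = H (ofL2 u)) : 0 ≤ quadForm M u y := by
  obtain ⟨γ, -, hγ⟩ := hH
  -- The scaled graph omits `u = 0`; there finite gain forces `y = 0`.
  by_cases hu : u = 0
  · obtain ⟨y', hy', hle⟩ := hγ u
    have hyy : y = y' := ofL2_injective (hy.trans hy')
    subst hyy
    have : y = 0 := by simpa [hu] using hle
    simp [quadForm, hu, this]
  have hu' : 0 < ‖u‖ := norm_pos_iff.2 hu
  have hz := (mem_region_iff hM _).1 (hSG ⟨u, y, hu, hy, Or.inl rfl⟩)
  have hg : 0 ≤ gain u y := div_nonneg (norm_nonneg _) (norm_nonneg _)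
  have hnorm : ‖(gain u y : ℂ) * Complex.exp (Complex.I * phase u y)‖ = gain u y := by
    rw [norm_mul, mul_comm Complex.I, Complex.norm_exp_ofReal_mul_I, mul_one, Complex.norm_real,
      Real.norm_of_nonneg hg]
  -- Modulus and real part recover `‖y‖ / ‖u‖` and `⟨u, y⟩ / ‖u‖²`, so the region inequality times
  -- `‖u‖²` is the quadratic form.
  have hre : ((gain u y : ℂ) * Complex.exp (Complex.I * phase u y)).re
      = inner ℝ u y / ‖u‖ ^ 2 := by
    rw [Complex.re_ofReal_mul, mul_comm Complex.I, Complex.exp_ofReal_mul_I_re]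
    by_cases hy0 : y = 0
    · simp [gain, hy0]
    have hy' : 0 < ‖y‖ := norm_pos_iff.2 hy0
    rw [phase, if_neg hy0, Real.cos_arccos, gain]
    · field_simp
    · exact (abs_le.1 (abs_real_inner_div_norm_mul_norm_le_one u y)).1
    · exact (abs_le.1 (abs_real_inner_div_norm_mul_norm_le_one u y)).2
  rw [hnorm, hre, gain] at hz
  have : quadForm M u y = ‖u‖ ^ 2 *
      (M 0 0 * (‖y‖ / ‖u‖) ^ 2 + 2 * M 0 1 * (inner ℝ u y / ‖u‖ ^ 2) + M 1 1) := by
    rw [quadForm]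
    field_simp
  rw [this]
  positivity

/-- For a causal operator and a multiplier with nonpositive output weight, the constraint also
holds for truncated signals. -/
theorem quadForm_truncL2_nonneg {n : ℕ} {H : L2e n → L2e n} (hc : IsCausal H)
    (hH : IsL2Stable H) {M : Matrix (Fin 2) (Fin 2) ℝ} (hM : M.IsSymm) (ha : M 0 0 ≤ 0)
    (hSG : softSG H ⊆ region M) (T : ℝ≥0) (u : L2e n) :
    0 ≤ quadForm M (truncL2 T u) (truncL2 T (H u)) := by
  obtain ⟨γ, -, hγ⟩ := id hH
  obtain ⟨y, hy, -⟩ := hγ (truncL2 T u)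
  have hq := quadForm_nonneg_of_softSG_subset hH hM hSG hy.symm
  have htr : truncL2 T (H u) = truncL2 T (ofL2 y) := by
    rw [← hy, ofL2_truncL2]
    exact truncL2_eq_of_P_eq (hc T u)
  rw [quadForm, inner_truncL2_left] at hq
  rw [quadForm, htr]
  -- Truncating `y` keeps the cross term and shrinks `‖y‖`; since `a ≤ 0`, the form can only grow.
  have h1 : ‖truncL2 T (ofL2 y)‖ ^ 2 ≤ ‖y‖ ^ 2 :=
    pow_le_pow_left₀ (norm_nonneg _) (norm_truncL2_ofL2_le T y) 2
  have h2 := mul_le_mul_of_nonpos_left h1 ha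
  linarith

/-! ### Separation of the regions -/

/-- Positive distance separates the real points of the two regions. -/
theorem lt_zero_of_setDist_pos {M₁ M₂ : Matrix (Fin 2) (Fin 2) ℝ} (hM₁ : M₁.IsSymm)
    (hM₂ : M₂.IsSymm) (ha : M₁ 0 0 < 0)
    (hdist : 0 < setDist (invSet (region M₁)) ((fun z : ℂ => -z) '' region M₂)) {w : ℝ}
    (hw : 0 ≤ M₂ 0 0 * w ^ 2 - 2 * M₂ 0 1 * w + M₂ 1 1) :
    M₁ 1 1 * w ^ 2 + 2 * M₁ 0 1 * w + M₁ 0 0 < 0 := by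
  by_contra! hcon
  have hw0 : w ≠ 0 := by
    rintro rfl
    simp at hcon
    linarith
  have h1 : (w : ℂ) ∈ invSet (region M₁) := by
    refine ⟨((w⁻¹ : ℝ) : ℂ), ?_, by simpa using hw0, by simp⟩
    rw [mem_region_iff hM₁, Complex.norm_real, Complex.ofReal_re, Real.norm_eq_abs, sq_abs]
    have : M₁ 0 0 * w⁻¹ ^ 2 + 2 * M₁ 0 1 * w⁻¹ + M₁ 1 1
        = (M₁ 1 1 * w ^ 2 + 2 * M₁ 0 1 * w + M₁ 0 0) / w ^ 2 := by
      field_simp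
      ring
    rw [this]
    positivity
  have h2 : (w : ℂ) ∈ (fun z : ℂ => -z) '' region M₂ := by
    refine ⟨((-w : ℝ) : ℂ), ?_, by simp⟩
    rw [mem_region_iff hM₂, Complex.norm_real, Complex.ofReal_re, Real.norm_eq_abs, sq_abs]
    linarith
  -- A common point would make the distance zero.
  have h3 : setDist (invSet (region M₁)) ((fun z : ℂ => -z) '' region M₂)
      ≤ edist (w : ℂ) (w : ℂ) :=
    (iInf₂_le (w : ℂ) h1).trans (iInf₂_le (w : ℂ) h2)
  rw [edist_self] at h3
  exact absurd hdist (not_lt.2 h3)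

/-- If a real disk `|w - p| ≤ r` lies in the open disk `|w - q| < R`, then `|p - q| + r < R`. -/
theorem abs_sub_add_lt_of_disk {p q r R : ℝ} (hR : 0 ≤ R)
    (h : ∀ w : ℝ, (w - p) ^ 2 ≤ r ^ 2 → (w - q) ^ 2 < R ^ 2) : |p - q| + r < R := by
  -- The two endpoints `p ± r` suffice.
  have h1 := abs_lt_of_sq_lt_sq (h (p + r) (by simp)) hR
  have h2 := abs_lt_of_sq_lt_sq (h (p - r) (by simp)) hR
  rw [abs_lt] at h1 h2
  rcases abs_cases (p - q) with ⟨h3, -⟩ | ⟨h3, -⟩ <;> linarith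

/-! ### The loop estimate -/

/-- Two vectors satisfying the loop equations and both quadratic constraints are bounded by the
external vectors, with a constant depending only on the multipliers. -/
theorem exists_norm_le_of_quadForm_nonneg {M₁ M₂ : Matrix (Fin 2) (Fin 2) ℝ}
    (hM₁ : IsPositiveNegative M₁) (hM₂ : IsPositiveNegative M₂)
    (hdist : 0 < setDist (invSet (region M₁)) ((fun z : ℂ => -z) '' region M₂))
    (V : Type*) [NormedAddCommGroup V] [InnerProductSpace ℝ V] :
    ∃ K : ℝ, 0 ≤ K ∧ ∀ e₁ e₂ u₁ u₂ : V, 0 ≤ quadForm M₁ e₁ (e₂ - u₂) →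
      0 ≤ quadForm M₂ e₂ (u₁ - e₁) →
      ‖e₁‖ ≤ K * (‖u₁‖ + ‖u₂‖) ∧ ‖e₂‖ ≤ K * (‖u₁‖ + ‖u₂‖) := by
  obtain ⟨hs₁, ε₁, hε₁, hc₁, ha₁⟩ := hM₁
  obtain ⟨hs₂, ε₂, hε₂, hc₂, ha₂⟩ := hM₂
  have hsep := fun w : ℝ => lt_zero_of_setDist_pos hs₁ hs₂ (by linarith) hdist (w := w)
  simp only [quadForm]
  generalize M₁ 0 0 = a₁ at *
  generalize M₁ 0 1 = b₁ at *
  generalize M₁ 1 1 = c₁ at *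
  generalize M₂ 0 0 = a₂ at *
  generalize M₂ 0 1 = b₂ at *
  generalize M₂ 1 1 = c₂ at *
  have hc₁ : 0 < c₁ := by linarith
  have ha₁ : a₁ < 0 := by linarith
  have hc₂ : 0 < c₂ := by linarith
  have ha₂ : a₂ < 0 := by linarith
  -- Completing squares turns the two real forms into `c₁((w - q)² - R²)` and `a₂((w - p)² - r²)`;
  -- the signs of `aᵢ, cᵢ` make both radicands nonnegative.
  obtain ⟨q, hq⟩ : ∃ q, q = -b₁ / c₁ := ⟨_, rfl⟩
  obtain ⟨p, hp⟩ : ∃ p, p = b₂ / a₂ := ⟨_, rfl⟩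
  have hb₁ : b₁ = -(c₁ * q) := by rw [hq]; field_simp
  have hb₂ : b₂ = a₂ * p := by rw [hp, mul_div_cancel₀ _ ha₂.ne]
  obtain ⟨R, hR⟩ : ∃ R, R = √(q ^ 2 - a₁ / c₁) := ⟨_, rfl⟩
  obtain ⟨r, hr⟩ : ∃ r, r = √(p ^ 2 - c₂ / a₂) := ⟨_, rfl⟩
  have hR0 : 0 ≤ R := hR ▸ Real.sqrt_nonneg _
  have hr0 : 0 ≤ r := hr ▸ Real.sqrt_nonneg _
  have hRa : a₁ = c₁ * (q ^ 2 - R ^ 2) := by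
    have : a₁ / c₁ ≤ 0 := div_nonpos_of_nonpos_of_nonneg ha₁.le hc₁.le
    rw [hR, Real.sq_sqrt (by nlinarith [sq_nonneg q])]
    field_simp
    ring
  have hrc : c₂ = a₂ * (p ^ 2 - r ^ 2) := by
    have : c₂ / a₂ ≤ 0 := div_nonpos_of_nonneg_of_nonpos hc₂.le ha₂.le
    rw [hr, Real.sq_sqrt (by nlinarith [sq_nonneg p]), sub_sub_cancel, mul_div_cancel₀ _ ha₂.ne]
  have hgap : |p - q| + r < R := by
    refine abs_sub_add_lt_of_disk hR0 fun w hw => ?_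
    have h := hsep w (by
      rw [hb₂, hrc]
      nlinarith [mul_nonneg_of_nonpos_of_nonpos ha₂.le (sub_nonpos.2 hw)])
    rw [hb₁, hRa] at h
    by_contra! hcon
    nlinarith [mul_nonneg hc₁.le (sub_nonneg.2 hcon)]
  have hδ : 0 < R - r - |p - q| := by linarith
  -- Chaining `k₁` to `k₅` gives `(R - r - |p - q|)‖e₂‖ ≤ ‖u₁‖ + (R + |q|)‖u₂‖`.
  obtain ⟨L, hL⟩ : ∃ L, L = (1 + R + |q|) / (R - r - |p - q|) := ⟨_, rfl⟩
  have hL0 : 0 ≤ L := by rw [hL]; positivity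
  refine ⟨(|p| + r + 1) * L + 1, by positivity, fun e₁ e₂ u₁ u₂ h₁ h₂ => ?_⟩
  have k₁ : R * ‖e₂ - u₂‖ ≤ ‖e₁ - q • (e₂ - u₂)‖ := by
    refine le_of_abs_le (abs_le_of_sq_le_sq ?_ (norm_nonneg _))
    rw [norm_sub_sq_real, norm_smul, inner_smul_right, mul_pow, mul_pow, Real.norm_eq_abs, sq_abs]
    rw [hb₁, hRa] at h₁
    refine le_of_mul_le_mul_left ?_ hc₁
    linarith
  have k₂ : ‖(u₁ - e₁) + p • e₂‖ ≤ r * ‖e₂‖ := by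
    refine le_of_abs_le (abs_le_of_sq_le_sq ?_ (by positivity))
    rw [norm_add_sq_real, norm_smul, inner_smul_right, mul_pow, mul_pow, Real.norm_eq_abs, sq_abs,
      real_inner_comm]
    rw [hb₂, hrc] at h₂
    refine le_of_mul_le_mul_left ?_ (neg_pos.2 ha₂)
    linarith
  have k₃ : ‖e₁ - p • e₂‖ ≤ r * ‖e₂‖ + ‖u₁‖ := by
    have : e₁ - p • e₂ = u₁ - ((u₁ - e₁) + p • e₂) := by abel
    rw [this]
    linarith [norm_sub_le u₁ ((u₁ - e₁) + p • e₂)]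
  have k₄ : ‖e₁ - q • (e₂ - u₂)‖ ≤ ‖e₁ - p • e₂‖ + |p - q| * ‖e₂‖ + |q| * ‖u₂‖ := by
    have : e₁ - q • (e₂ - u₂) = (e₁ - p • e₂) + (p - q) • e₂ + q • u₂ := by
      rw [smul_sub, sub_smul]; abel
    rw [this, ← Real.norm_eq_abs, ← Real.norm_eq_abs, ← norm_smul, ← norm_smul]
    exact norm_add₃_le
  have k₅ : R * (‖e₂‖ - ‖u₂‖) ≤ R * ‖e₂ - u₂‖ :=
    mul_le_mul_of_nonneg_left (norm_sub_norm_le _ _) hR0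
  have k₆ : ‖e₂‖ ≤ L * (‖u₁‖ + ‖u₂‖) := by
    rw [hL, div_mul_eq_mul_div, le_div_iff₀ hδ]
    nlinarith [norm_nonneg u₁, norm_nonneg u₂, mul_nonneg hR0 (norm_nonneg u₁),
      mul_nonneg (abs_nonneg q) (norm_nonneg u₁)]
  have k₇ : ‖e₁‖ ≤ (|p| + r) * ‖e₂‖ + ‖u₁‖ := by
    have : ‖e₁‖ ≤ ‖e₁ - p • e₂‖ + ‖p • e₂‖ := by
      simpa using norm_add_le (e₁ - p • e₂) (p • e₂)
    rw [norm_smul, Real.norm_eq_abs] at this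
    linarith
  have hpr : 0 ≤ |p| + r := by positivity
  have hU : 0 ≤ ‖u₁‖ + ‖u₂‖ := by positivity
  have k₈ := mul_le_mul_of_nonneg_left k₆ hpr
  have k₉ : 0 ≤ (|p| + r) * (L * (‖u₁‖ + ‖u₂‖)) := by positivity
  have k₁₀ : 0 ≤ L * (‖u₁‖ + ‖u₂‖) := by positivity
  constructor <;> linarith [norm_nonneg u₁, norm_nonneg u₂]

/-- Solutions of the two-input loop equations with square-integrable external signals are
square-integrable, with finite gain. -/
theorem exists_bound_of_loop_equations {n : ℕ} {H₁ H₂ : L2e n → L2e n} (hcausal₁ : IsCausal H₁)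
    (hcausal₂ : IsCausal H₂) (hstable₁ : IsL2Stable H₁) (hstable₂ : IsL2Stable H₂)
    {M₁ M₂ : Matrix (Fin 2) (Fin 2) ℝ} (hM₁ : IsPositiveNegative M₁)
    (hM₂ : IsPositiveNegative M₂) (hSG₁ : softSG H₁ ⊆ region M₁) (hSG₂ : softSG H₂ ⊆ region M₂)
    (hdist : 0 < setDist (invSet (region M₁)) ((fun z : ℂ => -z) '' region M₂)) :
    ∃ K : ℝ, 0 ≤ K ∧ ∀ (u₁ u₂ : L2 n) (e₁ e₂ : L2e n), e₁ = ofL2 u₁ - H₂ e₂ →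
      e₂ = ofL2 u₂ + H₁ e₁ → ∃ x₁ x₂ : L2 n, ofL2 x₁ = e₁ ∧ ofL2 x₂ = e₂ ∧
        ‖x₁‖ ≤ K * (‖u₁‖ + ‖u₂‖) ∧ ‖x₂‖ ≤ K * (‖u₁‖ + ‖u₂‖) := by
  obtain ⟨K, hK, hbound⟩ := exists_norm_le_of_quadForm_nonneg hM₁ hM₂ hdist (L2 n)
  refine ⟨K, hK, fun u₁ u₂ e₁ e₂ h₁ h₂ => ?_⟩
  obtain ⟨hs₁, ε₁, hε₁, -, ha₁⟩ := hM₁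
  obtain ⟨hs₂, ε₂, hε₂, -, ha₂⟩ := hM₂
  have key : ∀ T, ‖truncL2 T e₁‖ ≤ K * (‖u₁‖ + ‖u₂‖) ∧ ‖truncL2 T e₂‖ ≤ K * (‖u₁‖ + ‖u₂‖) := by
    intro T
    have q₁ := quadForm_truncL2_nonneg hcausal₁ hstable₁ hs₁ (by linarith) hSG₁ T e₁
    have q₂ := quadForm_truncL2_nonneg hcausal₂ hstable₂ hs₂ (by linarith) hSG₂ T e₂
    rw [show H₁ e₁ = e₂ - ofL2 u₂ from eq_sub_of_add_eq' h₂.symm, truncL2_sub] at q₁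
    rw [show H₂ e₂ = ofL2 u₁ - e₁ by rw [h₁]; abel, truncL2_sub] at q₂
    obtain ⟨b₁, b₂⟩ := hbound _ _ _ _ q₁ q₂
    have hle := mul_le_mul_of_nonneg_left
      (add_le_add (norm_truncL2_ofL2_le T u₁) (norm_truncL2_ofL2_le T u₂)) hK
    exact ⟨b₁.trans hle, b₂.trans hle⟩
  have hC : 0 ≤ K * (‖u₁‖ + ‖u₂‖) := by positivity
  obtain ⟨x₁, hx₁, hn₁⟩ := exists_ofL2_eq_of_norm_truncL2_le hC fun T => (key T).1
  obtain ⟨x₂, hx₂, hn₂⟩ := exists_ofL2_eq_of_norm_truncL2_le hC fun T => (key T).2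
  exact ⟨x₁, x₂, hx₁, hx₂, hn₁, hn₂⟩

end ScaledGraph

theorem mainTheorem4 {n : ℕ} (H₁ H₂ : ScaledGraph.L2e n → ScaledGraph.L2e n)
    (hcausal₁ : ScaledGraph.IsCausal H₁) (hcausal₂ : ScaledGraph.IsCausal H₂)
    (hstable₁ : ScaledGraph.IsL2Stable H₁) (hstable₂ : ScaledGraph.IsL2Stable H₂)
    (M₁ M₂ : Matrix (Fin 2) (Fin 2) ℝ)
    (hM₁ : ScaledGraph.IsPositiveNegative M₁) (hM₂ : ScaledGraph.IsPositiveNegative M₂)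
    (hSG₁ : ScaledGraph.softSG H₁ ⊆ ScaledGraph.region M₁)
    (hSG₂ : ScaledGraph.softSG H₂ ⊆ ScaledGraph.region M₂)
    (hdist : 0 < ScaledGraph.setDist (ScaledGraph.invSet (ScaledGraph.region M₁))
      ((fun z : ℂ => -z) '' ScaledGraph.region M₂)) :
    (ScaledGraph.IsWellPosed H₁ H₂ → ScaledGraph.IsFeedbackL2Stable H₁ H₂) ∧
    (ScaledGraph.IsWellPosed₂ H₁ H₂ → ScaledGraph.IsFeedbackL2Stable₂ H₁ H₂) := by
  obtain ⟨K, hK, hbound⟩ := ScaledGraph.exists_bound_of_loop_equations hcausal₁ hcausal₂ hstable₁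
    hstable₂ hM₁ hM₂ hSG₁ hSG₂ hdist
  constructor
  · rintro ⟨R, hR⟩
    have key : ∀ u : ScaledGraph.L2 n, ∃ x₁ x₂ : ScaledGraph.L2 n,
        ScaledGraph.ofL2 x₁ = R (ScaledGraph.ofL2 u) ∧
        ScaledGraph.ofL2 x₂ = H₁ (R (ScaledGraph.ofL2 u)) ∧ ‖x₁‖ ≤ K * ‖u‖ ∧ ‖x₂‖ ≤ K * ‖u‖ := by
      intro u
      have h0 : ScaledGraph.ofL2 (0 : ScaledGraph.L2 n) = 0 := rfl
      -- The one-input loop is the case `u₂ = 0`, where `e₂ = y`.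
      simpa using hbound u 0 (R (ScaledGraph.ofL2 u)) (H₁ (R (ScaledGraph.ofL2 u)))
        ((hR.2 _ _).2 rfl) (by rw [h0, zero_add])
    refine ⟨R, hR, ⟨K, hK, fun u => ?_⟩, ⟨K, hK, fun u => ?_⟩⟩
    · obtain ⟨x₁, -, h₁, -, hn₁, -⟩ := key u
      exact ⟨x₁, h₁.symm, hn₁⟩
    · obtain ⟨-, x₂, -, h₂, -, hn₂⟩ := key u
      exact ⟨x₂, h₂.symm, hn₂⟩
  · rintro ⟨R, hR⟩
    -- Each squared norm is at most `K²(‖u₁‖ + ‖u₂‖)² ≤ 2K²(‖u₁‖² + ‖u₂‖²)`.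
    refine ⟨R, hR, 4 * K ^ 2, by positivity, fun u₁ u₂ => ?_⟩
    obtain ⟨h₁, h₂⟩ := (hR.2 (ScaledGraph.ofL2 u₁) (ScaledGraph.ofL2 u₂) _ _).2 rfl
    obtain ⟨x₁, x₂, hx₁, hx₂, hn₁, hn₂⟩ := hbound u₁ u₂ _ _ h₁ h₂
    refine ⟨x₁, x₂, by rw [hx₁, hx₂], ?_⟩
    have s₁ := pow_le_pow_left₀ (norm_nonneg _) hn₁ 2
    have s₂ := pow_le_pow_left₀ (norm_nonneg _) hn₂ 2
    nlinarith [mul_nonneg (sq_nonneg K) (sq_nonneg (‖u₁‖ - ‖u₂‖))]
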